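/- Let $m\ge 3$ and $n=2^m-3$. Let $H^n$ be the $n$-dimensional hypercube graph, whose vertex set $V(H^n)=\{0,1\}^n$ consists of all binary words of length $n$, two words being adjacent if and only if they differ in exactly one position; let $d$ denote the Hamming distance, $+$ coordinatewise addition modulo $2$, and $\bar 1$ the all-one word. Let $C_1$ be any binary $(n,2^{n-m},3)$ code, i.e. any set $C_1\subseteq V(H^n)$ with $|C_1|=2^{n-m}$ and $d(\bar x,\bar y)\ge 3$ for all distinct $\bar x,\bar y\in C_1$. Put $$C_2=C_1+\bar 1=\{\bar x \mid \bar x+\bar 1\in C_1\},$$ $$C_3=\{\bar x \mid d(\bar x,C_1)=1\}\setminus C_2,$$ $$C_4=V(H^n)\setminus (C_1\cup C_2\cup C_3),$$ where $d(\bar x,C_1)=\min_{\bar c\in C_1}d(\bar x,\bar c)$. Then $\{C_1,C_2,C_3,C_4\}$ is an equitable partition of $H^n$ with quotient matrix $$(S_{ij})_{i,j=1}^4=\begin{pmatrix}0&1&n-1&0\\1&0&n-1&0\\1&1&n-4&2\\0&0&n-1&1\end{pmatrix};$$ that is, the sets $C_1,C_2,C_3,C_4$ are nonempty, pairwise disjoint,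 have union $V(H^n)$, and for all $i,j\in\{1,2,3,4\}$ every vertex $\bar x\in C_i$ has exactly $S_{ij}$ neighbors in $C_j$. -/

import Mathlib

/-- A binary word of length `n`. -/
abbrev BinaryWord (n : ℕ) : Type := Fin n → ZMod 2

/-- The hypercube `H^n`: the vertices are the binary words of length `n`, and two words are
adjacent if and only if they differ in exactly one position. -/
def hypercube (n : ℕ) : SimpleGraph (BinaryWord n) where
  Adj x y := hammingDist x y = 1
  symm := ⟨fun x y h => by rwa [hammingDist_comm]⟩
  loopless := ⟨fun x h => by simp at h⟩

/-- `C` is a binary `(n, M, d)` code: a set of `M` binary words of length `n` such that any two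
different words of it are at Hamming distance at least `d`. -/
def IsBinaryCode (n M d : ℕ) (C : Set (BinaryWord n)) : Prop :=
  C.encard = M ∧ ∀ x ∈ C, ∀ y ∈ C, x ≠ y → d ≤ hammingDist x y

/-- The parts `P 0, …, P (r - 1)` form an equitable partition of the vertex set of `G` with
quotient matrix `S`: they are nonempty, pairwise disjoint, cover all vertices, and every vertex
of `P i` has exactly `S i j` neighbors in `P j`. -/
structure IsEquitablePartition {V : Type*} (G : SimpleGraph V) {r : ℕ}
    (P : Fin r → Set V) (S : Matrix (Fin r) (Fin r) ℕ) : Prop where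
  nonempty : ∀ i, (P i).Nonempty
  disjoint : ∀ i j, i ≠ j → Disjoint (P i) (P j)
  cover : ⋃ i, P i = Set.univ
  neighbors : ∀ i j, ∀ x ∈ P i, (G.neighborSet x ∩ P j).encard = S i j

/-- The set `C + 1̄ = {x | x + 1̄ ∈ C}`, where `1̄` is the all-one word. -/
def antipodalSet {n : ℕ} (C : Set (BinaryWord n)) : Set (BinaryWord n) :=
  {x | x + 1 ∈ C}

/-- The words whose distance `d(x, C) = min {d(x, c) | c ∈ C}` from the set `C` equals `1`. -/
def distanceOneSet {n : ℕ} (C : Set (BinaryWord n)) : Set (BinaryWord n) :=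
  {x | IsLeast {k | ∃ c ∈ C, hammingDist x c = k} 1}

/-- The words at distance `1` from `C` that are not in `C + 1̄`. -/
def thirdPart {n : ℕ} (C : Set (BinaryWord n)) : Set (BinaryWord n) :=
  distanceOneSet C \ antipodalSet C

/-- The words that lie in none of the first three parts. -/
def fourthPart {n : ℕ} (C : Set (BinaryWord n)) : Set (BinaryWord n) :=
  (C ∪ antipodalSet C ∪ thirdPart C)ᶜ

/-! Let `f`, `f'`, `f₃` be the indicators of the first three parts, `A` the adjacency operator, and
h = A²f + 2Af − f − 2f' − (n−1). On nonzero characters, h has Fourier coefficient w·f̂ with w ≥ 0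
because n ≡ 1 mod 4; at 0 it vanishes because |C|(n+3) = 2^n. So ⟨f, h⟩ ≥ 0 by Parseval. Minimum
distance 3 gives A²f = n and Af = 0 on C, hence ⟨f, h⟩ = −2⟨f, f'⟩ ≤ 0. Equality forces C to be
disjoint from its antipode and h = 0 (`spectral_identity`).

Subtracting the antipodal copy of h = 0 gives (A+1)²(f − f') = 0, so (A+1)(f − f') = 0 as A is
symmetric. This yields Af = f' + f₃ and Af' = f + f₃; substituting into h = 0 gives Af₃ = n − 1 −
3f₃, and complementation gives the fourth part. -/

namespace BinaryWord

open Finset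

variable {n : ℕ}

/-! ### Characters and Parseval's identity on binary words -/

/-- The nontrivial sign character of `ZMod 2`. -/
def sign (a : ZMod 2) : ℤ := if a = 0 then 1 else -1

theorem sign_add : ∀ a b : ZMod 2, sign (a + b) = sign a * sign b := by decide

theorem sum_sign_mul : ∀ a : ZMod 2, ∑ b, sign (b * a) = if a = 0 then 2 else 0 := by decide

/-- The character of the group of binary words indexed by `u`. -/
def character (u x : BinaryWord n) : ℤ := ∏ i, sign (u i * x i)

theorem character_add (u x y : BinaryWord n) :
    character u (x + y) = character u x * character u y := by
  simp [character, mul_add, sign_add, prod_mul_distrib]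

theorem character_zero_left (x : BinaryWord n) : character 0 x = 1 := by
  simp [character, sign]

theorem character_single (u : BinaryWord n) (i : Fin n) :
    character u (Pi.single i 1) = sign (u i) := by
  unfold character
  rw [Fintype.prod_eq_single i]
  · simp
  · intro j hj
    simp [Pi.single_eq_of_ne hj, sign]

theorem sum_character (x : BinaryWord n) :
    ∑ u, character u x = if x = 0 then 2 ^ n else 0 := by
  have h := Finset.prod_univ_sum (fun _ : Fin n => (univ : Finset (ZMod 2)))
    (fun i a => sign (a * x i))
  rw [Fintype.piFinset_univ] at h
  unfold character
  rw [← h]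
  simp only [sum_sign_mul]
  split_ifs with hx
  · simp [hx]
  · obtain ⟨i, hi⟩ := Function.ne_iff.mp hx
    exact prod_eq_zero (mem_univ i) (if_neg hi)

theorem add_self (x : BinaryWord n) : x + x = 0 :=
  funext fun i => CharTwo.add_self_eq_zero (x i)

theorem add_eq_zero {x y : BinaryWord n} : x + y = 0 ↔ x = y := by
  simp only [funext_iff, Pi.add_apply, Pi.zero_apply, CharTwo.add_eq_zero]

theorem add_add_self (x y : BinaryWord n) : x + y + y = x := by
  rw [add_assoc, add_self, add_zero]

theorem sum_shift (g : BinaryWord n → ℤ) (y : BinaryWord n) : ∑ x, g (x + y) = ∑ x, g x :=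
  Equiv.sum_comp (Equiv.addRight y) g

/-- The unnormalized Fourier transform on the group of binary words. -/
def fourier (g : BinaryWord n → ℤ) (u : BinaryWord n) : ℤ := ∑ x, g x * character u x

theorem sum_fourier_mul (g h : BinaryWord n → ℤ) :
    ∑ u, fourier g u * fourier h u = 2 ^ n * ∑ x, g x * h x := by
  have key (u : BinaryWord n) : fourier g u * fourier h u =
      ∑ x, ∑ y, g x * h y * character u (x + y) := by
    simp only [fourier, sum_mul_sum, character_add]
    exact sum_congr rfl fun x _ => sum_congr rfl fun y _ => by ring
  simp only [key]
  rw [sum_comm, mul_sum]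
  refine sum_congr rfl fun x _ => ?_
  rw [sum_comm, Fintype.sum_eq_single x]
  · rw [← mul_sum, sum_character, if_pos (add_self x)]
    ring
  · intro y hy
    rw [← mul_sum, sum_character, if_neg fun h => hy (add_eq_zero.mp h).symm, mul_zero]

/-- Parseval applied to `g` with itself gives ∑ g² = 0. -/
theorem eq_zero_of_fourier_eq_zero {g : BinaryWord n → ℤ} (hg : ∀ u, fourier g u = 0)
    (x : BinaryWord n) : g x = 0 := by
  have h := sum_fourier_mul g g
  simp only [hg, mul_zero, sum_const_zero] at h
  have h' : ∑ x, g x * g x = 0 := by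
    rcases mul_eq_zero.mp h.symm with h | h
    · exact absurd h (by positivity)
    · exact h
  exact mul_self_eq_zero.mp
    ((sum_eq_zero_iff_of_nonneg fun x _ => mul_self_nonneg (g x)).mp h' x (mem_univ x))

theorem fourier_shift (g : BinaryWord n → ℤ) (y u : BinaryWord n) :
    fourier (fun x => g (x + y)) u = character u y * fourier g u := by
  unfold fourier
  rw [← sum_shift (fun x => g x * character u x) y, mul_sum]
  refine sum_congr rfl fun x _ => ?_
  have h : character u y * character u y = 1 := by
    rw [← character_add, add_self]
    simp [character, sign]
  rw [character_add]
  linear_combination (-(g (x + y) * character u x)) * h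

/-! ### Spectrum of the hypercube -/

/-- The adjacency operator of the hypercube. -/
def adjSum (g : BinaryWord n → ℤ) (x : BinaryWord n) : ℤ := ∑ i, g (x + Pi.single i 1)

theorem fourier_adjSum (g : BinaryWord n → ℤ) (u : BinaryWord n) :
    fourier (adjSum g) u = (∑ i, sign (u i)) * fourier g u := by
  have h : fourier (adjSum g) u = ∑ i, fourier (fun x => g (x + Pi.single i 1)) u := by
    simp only [fourier, adjSum, sum_mul]
    exact sum_comm
  simp only [h, fourier_shift, character_single, sum_mul]

theorem adjSum_shift (g : BinaryWord n → ℤ) (y x : BinaryWord n) :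
    adjSum (fun z => g (z + y)) x = adjSum g (x + y) := by
  simp only [adjSum, add_right_comm]

theorem sum_adjSum_mul (g h : BinaryWord n → ℤ) :
    ∑ x, adjSum g x * h x = ∑ x, g x * adjSum h x := by
  simp only [adjSum, sum_mul, mul_sum]
  rw [sum_comm, sum_comm (s := univ (α := BinaryWord n))]
  refine sum_congr rfl fun i _ => ?_
  rw [← sum_shift _ (Pi.single i 1)]
  simp only [add_add_self]

/-- Here `k` is the Hamming weight of `u`. -/
theorem sum_sign_and_character_one (u : BinaryWord n) :
    ∃ k : ℕ, ∑ i, sign (u i) = n - 2 * k ∧ character u 1 = (-1) ^ k := by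
  refine ⟨#{i | ¬ u i = 0}, ?_, ?_⟩
  · have h (a : ZMod 2) : sign a = 1 - 2 * (if ¬ a = 0 then 1 else 0) := by
      revert a; decide
    simp only [h, sum_sub_distrib, ← mul_sum, sum_boole]
    simp
  · simp [character, sign, prod_ite]

/-- With eigenvalue s = n − 2k, the expression is (s+1)² − 4 for even k and (s+1)² for odd k. In the
even case s + 1 ≡ 2 mod 4, so |s+1| ≥ 2. -/
theorem eigenvalue_nonneg (hn : n % 4 = 1) (u : BinaryWord n) :
    0 ≤ (∑ i, sign (u i)) ^ 2 + 2 * (∑ i, sign (u i)) - 1 - 2 * character u 1 := by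
  obtain ⟨k, hs, hc⟩ := sum_sign_and_character_one u
  obtain ⟨j, hj⟩ : ∃ j : ℕ, n = 4 * j + 1 := ⟨n / 4, by omega⟩
  rw [hs, hc, hj]
  push_cast
  rcases Nat.even_or_odd' k with ⟨t, rfl | rfl⟩
  -- (s+1)² − 4 = 16(j−t)(j−t+1), a multiple of a product of consecutive integers.
  · have h : 0 ≤ ((j : ℤ) - t) * (j - t + 1) := by
      rcases le_or_gt 0 ((j : ℤ) - t) with h | h
      · positivity
      · exact mul_nonneg_of_nonpos_of_nonpos h.le (by omega)
    rw [pow_mul]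
    push_cast
    norm_num
    linarith
  · rw [pow_succ (-1 : ℤ), pow_mul]
    push_cast
    norm_num
    nlinarith [sq_nonneg (4 * (j : ℤ) + 1 - 2 * (2 * t + 1) + 1)]

/-! ### Neighbors and indicator functions -/

theorem hammingDist_add_single (x : BinaryWord n) (i : Fin n) :
    hammingDist x (x + Pi.single i 1) = 1 := by
  unfold hammingDist
  rw [card_eq_one]
  refine ⟨i, ?_⟩
  ext j
  by_cases h : j = i
  · subst h; simp
  · simp [h]

theorem hammingDist_eq_one {x y : BinaryWord n} :
    hammingDist x y = 1 ↔ ∃ i, x + Pi.single i 1 = y := by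
  refine ⟨fun h => ?_, ?_⟩
  · obtain ⟨i, hi⟩ := card_eq_one.mp h
    refine ⟨i, funext fun j => ?_⟩
    have hj : x j ≠ y j ↔ j = i := by
      simpa using Finset.ext_iff.mp hi j
    by_cases h : j = i
    · subst h
      have := hj.mpr rfl
      have key : ∀ a b : ZMod 2, a ≠ b → a + 1 = b := by decide
      simpa using key _ _ this
    · simpa [h] using mt hj.mp h
  · rintro ⟨i, rfl⟩
    exact hammingDist_add_single x i

theorem single_injective :
    Function.Injective fun i : Fin n => (Pi.single i 1 : BinaryWord n) := by
  intro i j h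
  by_contra hij
  have := congrFun h i
  simp [hij] at this

open Classical in
/-- The integer-valued indicator function of a set of binary words. -/
noncomputable def ind (P : Set (BinaryWord n)) (x : BinaryWord n) : ℤ := if x ∈ P then 1 else 0

theorem ind_of_mem {P : Set (BinaryWord n)} {x : BinaryWord n} (h : x ∈ P) : ind P x = 1 :=
  if_pos h

theorem ind_of_notMem {P : Set (BinaryWord n)} {x : BinaryWord n} (h : x ∉ P) : ind P x = 0 :=
  if_neg h

theorem ind_nonneg (P : Set (BinaryWord n)) (x : BinaryWord n) : 0 ≤ ind P x := by
  unfold ind; split_ifs <;> simp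

theorem encard_neighborSet_inter {P : Set (BinaryWord n)} {x : BinaryWord n} {k : ℕ}
    (h : adjSum (ind P) x = k) : ((hypercube n).neighborSet x ∩ P).encard = k := by
  classical
  have himage : (hypercube n).neighborSet x ∩ P =
      (fun i => x + Pi.single i 1) '' {i : Fin n | x + Pi.single i 1 ∈ P} := by
    ext y
    constructor
    · rintro ⟨hy, hP⟩
      obtain ⟨i, rfl⟩ := hammingDist_eq_one.mp hy
      exact ⟨i, hP, rfl⟩
    · rintro ⟨i, hi, rfl⟩
      exact ⟨hammingDist_add_single x i, hi⟩
  rw [himage, Function.Injective.encard_image fun i j hij => single_injective (add_left_cancel hij),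
    Set.encard_eq_coe_toFinset_card, Set.toFinset_ofPred]
  simp only [adjSum, ind, sum_boole] at h
  exact_mod_cast h

theorem exists_add_single_mem {P : Set (BinaryWord n)} {x : BinaryWord n}
    (h : adjSum (ind P) x ≠ 0) : ∃ i, x + Pi.single i 1 ∈ P := by
  by_contra! hP
  exact h (sum_eq_zero fun i _ => ind_of_notMem (hP i))

theorem ind_antipodalSet (C : Set (BinaryWord n)) (x : BinaryWord n) :
    ind (antipodalSet C) x = ind C (x + 1) := rfl

/-! ### Codes of minimum distance 3 and the spectral identity -/

section Code

variable {M : ℕ} {C : Set (BinaryWord n)}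

theorem adjSum_eq_zero_of_mem (hC : IsBinaryCode n M 3 C) {x : BinaryWord n} (hx : x ∈ C) :
    adjSum (ind C) x = 0 := by
  refine sum_eq_zero fun i _ => ind_of_notMem fun hi => ?_
  have h := hammingDist_add_single x i
  have h3 := hC.2 x hx _ hi (hammingDist_ne_zero.mp (by omega))
  omega

theorem add_single_injOn (hC : IsBinaryCode n M 3 C) {x : BinaryWord n} {i j : Fin n}
    (hi : x + Pi.single i 1 ∈ C) (hj : x + Pi.single j 1 ∈ C) : i = j := by
  by_contra hij
  have hne : x + Pi.single i 1 ≠ x + Pi.single j 1 := fun h =>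
    hij (single_injective (add_left_cancel h))
  have h3 := hC.2 _ hi _ hj hne
  have htri := hammingDist_triangle (x + Pi.single i 1) x (x + Pi.single j 1)
  rw [hammingDist_comm _ x, hammingDist_add_single, hammingDist_add_single] at htri
  omega

theorem adjSum_eq_one_of_mem (hC : IsBinaryCode n M 3 C) {x : BinaryWord n} {i : Fin n}
    (hi : x + Pi.single i 1 ∈ C) : adjSum (ind C) x = 1 := by
  unfold adjSum
  rw [Fintype.sum_eq_single i, ind_of_mem hi]
  exact fun j hj => ind_of_notMem fun h => hj (add_single_injOn hC h hi)

/-- Each of the n neighbors of a codeword has that codeword as its only neighbor in the code. -/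
theorem adjSum_adjSum_of_mem (hC : IsBinaryCode n M 3 C) {x : BinaryWord n} (hx : x ∈ C) :
    adjSum (adjSum (ind C)) x = n := by
  have h (i : Fin n) : adjSum (ind C) (x + Pi.single i 1) = 1 :=
    adjSum_eq_one_of_mem hC (i := i) (by rwa [add_add_self])
  unfold adjSum at h ⊢
  simp [h]

theorem sum_ind (hC : C.encard = M) : ∑ x, ind C x = M := by
  classical
  simp only [ind, sum_boole]
  rw [Set.encard_eq_coe_toFinset_card] at hC
  have h : #{x | x ∈ C} = M := by
    rw [← Set.toFinset_ofPred]
    exact_mod_cast hC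
  exact_mod_cast h

theorem spectral_identity (hC : IsBinaryCode n M 3 C) (hn : n % 4 = 1)
    (hM : M * (n + 3) = 2 ^ n) :
    Disjoint C (antipodalSet C) ∧ ∀ x, adjSum (adjSum (ind C)) x + 2 * adjSum (ind C) x -
      ind C x - 2 * ind C (x + 1) = n - 1 := by
  set f := ind C with hf
  set w : BinaryWord n → ℤ := fun u =>
    (∑ i, sign (u i)) ^ 2 + 2 * (∑ i, sign (u i)) - 1 - 2 * character u 1 with hw
  set h : BinaryWord n → ℤ := fun x =>
    adjSum (adjSum f) x + 2 * adjSum f x - f x - 2 * f (x + 1) - (n - 1) with hh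
  have hfourier (u : BinaryWord n) :
      fourier h u = w u * fourier f u - (n - 1) * (if u = 0 then 2 ^ n else 0) := by
    have hlin : fourier h u = fourier (adjSum (adjSum f)) u + 2 * fourier (adjSum f) u -
        fourier f u - 2 * fourier (fun x => f (x + 1)) u - (n - 1) * ∑ x, character u x := by
      simp only [fourier, hh, mul_sum, ← sum_add_distrib, ← sum_sub_distrib]
      exact sum_congr rfl fun x _ => by ring
    have hcomm : ∑ x, character u x = ∑ x, character x u :=
      sum_congr rfl fun x _ => by simp only [character, mul_comm]
    rw [hlin, hcomm, sum_character, fourier_adjSum, fourier_adjSum, fourier_shift]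
    simp only [hw]
    ring
  have hzero : fourier h 0 = 0 := by
    have hf0 : fourier f 0 = M := by
      simp only [fourier, character_zero_left, mul_one]
      exact sum_ind hC.1
    rw [hfourier, if_pos rfl, hf0]
    simp only [hw, character_zero_left, Pi.zero_apply, sign, if_true, sum_const, card_univ,
      Fintype.card_fin, nsmul_eq_mul, mul_one]
    have hM' : (M : ℤ) * (n + 3) = 2 ^ n := by exact_mod_cast hM
    linear_combination ((n : ℤ) - 1) * hM'
  have hne {u : BinaryWord n} (hu : u ≠ 0) : fourier h u = w u * fourier f u := by
    rw [hfourier, if_neg hu]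
    ring
  have hterm (u : BinaryWord n) : 0 ≤ fourier f u * fourier h u := by
    by_cases hu : u = 0
    · rw [hu, hzero, mul_zero]
    · rw [hne hu]
      nlinarith [mul_nonneg (eigenvalue_nonneg hn u) (mul_self_nonneg (fourier f u))]
  have hfh (x : BinaryWord n) : f x * h x = -2 * (f x * f (x + 1)) := by
    by_cases hx : x ∈ C
    · simp only [hh, hf, adjSum_adjSum_of_mem hC hx, adjSum_eq_zero_of_mem hC hx, ind_of_mem hx]
      ring
    · simp [hf, ind_of_notMem hx]
  have hprod (x : BinaryWord n) : 0 ≤ f x * f (x + 1) :=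
    mul_nonneg (ind_nonneg _ _) (ind_nonneg _ _)
  have hparseval := sum_fourier_mul f h
  simp only [hfh, ← mul_sum] at hparseval
  have hsum := sum_nonneg fun u (_ : u ∈ univ) => hterm u
  have hsum' := sum_nonneg fun x (_ : x ∈ univ) => hprod x
  have hpow : (0 : ℤ) < 2 ^ n := by positivity
  -- Parseval equates a nonnegative sum with −2·2^n times another nonnegative sum, so both vanish.
  have hdisj : ∑ x, f x * f (x + 1) = 0 := by nlinarith
  rw [hdisj, mul_zero, mul_zero] at hparseval
  refine ⟨Set.disjoint_left.mpr fun x hx hx' => ?_, fun x => ?_⟩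
  · have := (sum_eq_zero_iff_of_nonneg fun x _ => hprod x).mp hdisj x (mem_univ x)
    rw [hf, ← ind_antipodalSet, ind_of_mem hx, ind_of_mem hx'] at this
    simp at this
  · refine sub_eq_zero.mp (eq_zero_of_fourier_eq_zero (g := h) (fun u => ?_) x)
    have := (sum_eq_zero_iff_of_nonneg fun u _ => hterm u).mp hparseval u (mem_univ u)
    rcases mul_eq_zero.mp this with h0 | h0
    · by_cases hu : u = 0
      · rw [hu, hzero]
      · rw [hne hu, h0, mul_zero]
    · exact h0

/-! ### Neighbor counts in the four parts -/

theorem adjSum_add (g h : BinaryWord n → ℤ) (x : BinaryWord n) :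
    adjSum (fun y => g y + h y) x = adjSum g x + adjSum h x := sum_add_distrib

theorem adjSum_sub (g h : BinaryWord n → ℤ) (x : BinaryWord n) :
    adjSum (fun y => g y - h y) x = adjSum g x - adjSum h x := sum_sub_distrib _ _

/-- The adjacency operator A is symmetric, so ‖(A+1)g‖² = ⟨(A+1)²g, g⟩ = 0. -/
theorem adjSum_add_self_eq_zero {g : BinaryWord n → ℤ}
    (hg : ∀ x, adjSum (adjSum g) x + 2 * adjSum g x + g x = 0) (x : BinaryWord n) :
    adjSum g x + g x = 0 := by
  have hsum : ∑ x, (adjSum g x + g x) * (adjSum g x + g x) = 0 := by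
    have hself := sum_adjSum_mul g (adjSum g)
    calc ∑ x, (adjSum g x + g x) * (adjSum g x + g x)
        = ∑ x, adjSum g x * adjSum g x + ∑ x, (2 * adjSum g x + g x) * g x := by
          rw [← sum_add_distrib]
          exact sum_congr rfl fun x _ => by ring
      _ = ∑ x, (adjSum (adjSum g) x + 2 * adjSum g x + g x) * g x := by
          rw [hself, ← sum_add_distrib]
          exact sum_congr rfl fun x _ => by ring
      _ = 0 := by simp [hg]
  exact mul_self_eq_zero.mp
    ((sum_eq_zero_iff_of_nonneg fun x _ => mul_self_nonneg _).mp hsum x (mem_univ x))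

theorem mem_distanceOneSet {x : BinaryWord n} :
    x ∈ distanceOneSet C ↔ x ∉ C ∧ ∃ i, x + Pi.single i 1 ∈ C := by
  constructor
  · rintro ⟨⟨c, hc, hd⟩, hlow⟩
    refine ⟨fun hx => ?_, ?_⟩
    · have := hlow ⟨x, hx, hammingDist_self x⟩
      omega
    · obtain ⟨i, rfl⟩ := hammingDist_eq_one.mp hd
      exact ⟨i, hc⟩
  · rintro ⟨hx, i, hi⟩
    refine ⟨⟨_, hi, hammingDist_add_single x i⟩, ?_⟩
    rintro k ⟨c, hc, rfl⟩
    rw [Nat.one_le_iff_ne_zero, hammingDist_ne_zero]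
    rintro rfl
    exact hx hc

theorem adjSum_antipodalSet (x : BinaryWord n) :
    adjSum (ind (antipodalSet C)) x = adjSum (ind C) (x + 1) := adjSum_shift (ind C) 1 x

theorem adjSum_adjSum_antipodalSet (x : BinaryWord n) :
    adjSum (adjSum (ind (antipodalSet C))) x = adjSum (adjSum (ind C)) (x + 1) := by
  rw [← adjSum_shift]
  exact congrArg (adjSum · x) (funext adjSum_antipodalSet)

theorem adjSum_sub_adjSum_antipodalSet (hC : IsBinaryCode n M 3 C) (hn : n % 4 = 1)
    (hM : M * (n + 3) = 2 ^ n) (x : BinaryWord n) :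
    adjSum (ind C) x + ind C x = adjSum (ind (antipodalSet C)) x + ind (antipodalSet C) x := by
  have h := adjSum_add_self_eq_zero (g := fun x => ind C x - ind (antipodalSet C) x)
    (fun x => ?_) x
  · rw [adjSum_sub] at h
    linarith
  · have hx := (spectral_identity hC hn hM).2 x
    have hx' := (spectral_identity hC hn hM).2 (x + 1)
    rw [add_add_self] at hx'
    rw [funext (adjSum_sub (ind C) (ind (antipodalSet C))), adjSum_sub,
      adjSum_adjSum_antipodalSet, ind_antipodalSet]
    simp only [adjSum_antipodalSet]
    linarith

theorem adjSum_of_mem_thirdPart (hC : IsBinaryCode n M 3 C) {x : BinaryWord n}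
    (hx : x ∈ thirdPart C) : adjSum (ind C) x = 1 := by
  obtain ⟨-, i, hi⟩ := mem_distanceOneSet.mp hx.1
  exact adjSum_eq_one_of_mem hC hi

theorem adjSum_of_mem_fourthPart {x : BinaryWord n} (hx : x ∈ fourthPart C) :
    adjSum (ind C) x = 0 := by
  simp only [fourthPart, thirdPart, Set.mem_compl_iff, Set.mem_union, not_or, Set.mem_sdiff,
    not_and, not_not] at hx
  refine sum_eq_zero fun i _ => ind_of_notMem fun hi => ?_
  exact hx.1.2 (hx.2 (mem_distanceOneSet.mpr ⟨hx.1.1, i, hi⟩))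

theorem ind_parts (hd : Disjoint C (antipodalSet C)) (x : BinaryWord n) :
    x ∈ C ∧ ind C x = 1 ∧ ind (antipodalSet C) x = 0 ∧ ind (thirdPart C) x = 0 ∧
      ind (fourthPart C) x = 0 ∨
    x ∈ antipodalSet C ∧ ind C x = 0 ∧ ind (antipodalSet C) x = 1 ∧ ind (thirdPart C) x = 0 ∧
      ind (fourthPart C) x = 0 ∨
    x ∈ thirdPart C ∧ ind C x = 0 ∧ ind (antipodalSet C) x = 0 ∧ ind (thirdPart C) x = 1 ∧
      ind (fourthPart C) x = 0 ∨
    x ∈ fourthPart C ∧ ind C x = 0 ∧ ind (antipodalSet C) x = 0 ∧ ind (thirdPart C) x = 0 ∧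
      ind (fourthPart C) x = 1 := by
  have h1 : x ∈ C → x ∉ antipodalSet C := fun h => Set.disjoint_left.mp hd h
  have h3 : x ∈ thirdPart C → x ∉ C ∧ x ∉ antipodalSet C := fun h =>
    ⟨(mem_distanceOneSet.mp h.1).1, h.2⟩
  have h4 : x ∈ fourthPart C ↔ x ∉ C ∧ x ∉ antipodalSet C ∧ x ∉ thirdPart C := by
    simp only [fourthPart, Set.mem_compl_iff, Set.mem_union, not_or, and_assoc]
  unfold ind
  by_cases hC : x ∈ C <;> by_cases hA : x ∈ antipodalSet C <;> by_cases hT : x ∈ thirdPart C <;>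
    simp_all

/-- The numbers of neighbors in each part, for a vertex of each part. -/
theorem adjSum_parts (hC : IsBinaryCode n M 3 C) (hn : n % 4 = 1)
    (hM : M * (n + 3) = 2 ^ n) (x : BinaryWord n) :
    adjSum (ind C) x = ind (antipodalSet C) x + ind (thirdPart C) x ∧
    adjSum (ind (antipodalSet C)) x = ind C x + ind (thirdPart C) x ∧
    adjSum (ind (thirdPart C)) x = n - 1 - 3 * ind (thirdPart C) x ∧
    adjSum (ind (fourthPart C)) x = ind (fourthPart C) x + 2 * ind (thirdPart C) x := by
  obtain ⟨hd, hspec⟩ := spectral_identity hC hn hM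
  have hdiff := adjSum_sub_adjSum_antipodalSet hC hn hM
  have hfirst (x : BinaryWord n) :
      adjSum (ind C) x = ind (antipodalSet C) x + ind (thirdPart C) x := by
    rcases ind_parts hd x with ⟨hx, h1, h2, h3, h4⟩ | ⟨hx, h1, h2, h3, h4⟩ |
      ⟨hx, h1, h2, h3, h4⟩ | ⟨hx, h1, h2, h3, h4⟩
    · rw [adjSum_eq_zero_of_mem hC hx, h2, h3, add_zero]
    -- For x in the antipode, x + 1 is a codeword, so x has no neighbor in the antipode and `hdiff`
    -- leaves exactly one in C.
    · have hx0 := adjSum_eq_zero_of_mem hC hx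
      have := hdiff x
      rw [adjSum_antipodalSet] at this
      linarith
    · rw [adjSum_of_mem_thirdPart hC hx, h2, h3, zero_add]
    · rw [adjSum_of_mem_fourthPart hx, h2, h3, add_zero]
  have hsecond (x : BinaryWord n) :
      adjSum (ind (antipodalSet C)) x = ind C x + ind (thirdPart C) x := by
    linarith [hfirst x, hdiff x]
  have hthird : adjSum (ind (thirdPart C)) x = n - 1 - 3 * ind (thirdPart C) x := by
    have hx := hspec x
    have hx' := hspec (x + 1)
    rw [add_add_self, ← adjSum_adjSum_antipodalSet, ← adjSum_antipodalSet] at hx'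
    rw [← ind_antipodalSet] at hx hx'
    rw [funext hfirst, adjSum_add] at hx
    rw [funext hsecond, adjSum_add] at hx'
    linarith [hfirst x, hsecond x]
  refine ⟨hfirst x, hsecond x, hthird, ?_⟩
  have htotal : ind (fourthPart C) = fun x =>
      1 - (ind C x + ind (antipodalSet C) x + ind (thirdPart C) x) := by
    funext y
    rcases ind_parts hd y with ⟨-, h1, h2, h3, h4⟩ | ⟨-, h1, h2, h3, h4⟩ |
      ⟨-, h1, h2, h3, h4⟩ | ⟨-, h1, h2, h3, h4⟩ <;> rw [h1, h2, h3, h4] <;> rfl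
  have hone : adjSum (fun _ : BinaryWord n => 1) x = n := by simp [adjSum]
  have hadj := congrArg (adjSum · x) htotal
  simp only [adjSum_sub, adjSum_add, hone] at hadj
  have hx := congrFun htotal x
  linarith [hfirst x, hsecond x]

end Code

end BinaryWord

/-! ### Assembling the equitable partition -/

theorem mainTheorem1 (m n : ℕ) (hm : 3 ≤ m) (hn : n = 2 ^ m - 3)
    (C : Set (BinaryWord n)) (hC : IsBinaryCode n (2 ^ (n - m)) 3 C) :
    IsEquitablePartition (hypercube n)
      ![C, antipodalSet C, thirdPart C, fourthPart C]
      !![0, 1, n - 1, 0;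
         1, 0, n - 1, 0;
         1, 1, n - 4, 2;
         0, 0, n - 1, 1] := by
  -- Ensures m ≤ n, so that the truncated `n - m` and `2 ^ m - 3` are genuine differences.
  have hpow : m + 3 ≤ 2 ^ m := by
    clear hn hC
    induction m, hm using Nat.le_induction with
    | base => norm_num
    | succ k hk ih => rw [pow_succ]; omega
  have hmod : n % 4 = 1 := by
    have : 2 ^ m = 4 * 2 ^ (m - 2) := by
      rw [← pow_mul_pow_sub 2 (show 2 ≤ m by omega)]
      norm_num
    omega
  -- Makes the natural subtractions `n - 1` and `n - 4` in the matrix agree with the integer counts.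
  have hn5 : 5 ≤ n := by omega
  have hM : 2 ^ (n - m) * (n + 3) = 2 ^ n := by
    rw [show n + 3 = 2 ^ m by omega, ← pow_add]
    congr 1
    omega
  have hd := (BinaryWord.spectral_identity hC hmod hM).1
  have hparts := BinaryWord.ind_parts hd
  have hadj := BinaryWord.adjSum_parts hC hmod hM
  have h1 : C.Nonempty := by
    rw [← Set.encard_ne_zero, hC.1]
    simp
  obtain ⟨c, hc⟩ := h1
  have h2 : c + 1 ∈ antipodalSet C := by
    change c + 1 + 1 ∈ C
    rwa [BinaryWord.add_add_self]
  -- A codeword has n − 1 > 0 neighbors in the third part, and a vertex there has 2 in the fourth,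
  -- so both are nonempty.
  obtain ⟨t, ht⟩ : (thirdPart C).Nonempty := by
    have h := (hadj c).2.2.1
    have h0 : BinaryWord.ind (thirdPart C) c = 0 :=
      BinaryWord.ind_of_notMem fun h => (BinaryWord.mem_distanceOneSet.mp h.1).1 hc
    obtain ⟨i, hi⟩ := BinaryWord.exists_add_single_mem (P := thirdPart C) (x := c)
      (by rw [h, h0]; omega)
    exact ⟨_, hi⟩
  obtain ⟨q, hq⟩ : (fourthPart C).Nonempty := by
    have h := (hadj t).2.2.2
    rw [BinaryWord.ind_of_mem ht] at h
    obtain ⟨i, hi⟩ := BinaryWord.exists_add_single_mem (P := fourthPart C) (x := t)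
      (by linarith [BinaryWord.ind_nonneg (fourthPart C) t])
    exact ⟨_, hi⟩
  have h13 : Disjoint C (thirdPart C) := Set.disjoint_left.mpr fun x hx h =>
    (BinaryWord.mem_distanceOneSet.mp h.1).1 hx
  have h23 : Disjoint (antipodalSet C) (thirdPart C) := Set.disjoint_sdiff_right
  have h14 : Disjoint C (fourthPart C) := Set.disjoint_left.mpr fun x hx h =>
    h (Or.inl (Or.inl hx))
  have h24 : Disjoint (antipodalSet C) (fourthPart C) := Set.disjoint_left.mpr fun x hx h =>
    h (Or.inl (Or.inr hx))
  have h34 : Disjoint (thirdPart C) (fourthPart C) := Set.disjoint_left.mpr fun x hx h =>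
    h (Or.inr hx)
  constructor
  · intro i
    fin_cases i
    exacts [⟨c, hc⟩, ⟨_, h2⟩, ⟨t, ht⟩, ⟨q, hq⟩]
  · intro i j hij
    fin_cases i <;> fin_cases j
    exacts [absurd rfl hij, hd, h13, h14, hd.symm, absurd rfl hij, h23, h24, h13.symm, h23.symm,
      absurd rfl hij, h34, h14.symm, h24.symm, h34.symm, absurd rfl hij]
  · refine Set.eq_univ_of_forall fun x => Set.mem_iUnion.mpr ?_
    rcases hparts x with h | h | h | h
    exacts [⟨0, h.1⟩, ⟨1, h.1⟩, ⟨2, h.1⟩, ⟨3, h.1⟩]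
  · intro i j x hx
    obtain ⟨a1, a2, a3, a4⟩ := hadj x
    fin_cases i
    · have hx : x ∈ C := hx
      rw [BinaryWord.ind_of_notMem (Set.disjoint_left.mp h13 hx)] at a1 a2 a3 a4
      rw [BinaryWord.ind_of_notMem (Set.disjoint_left.mp hd hx)] at a1
      rw [BinaryWord.ind_of_mem hx] at a2
      rw [BinaryWord.ind_of_notMem (Set.disjoint_left.mp h14 hx)] at a4
      fin_cases j <;> refine BinaryWord.encard_neighborSet_inter ?_
      exacts [a1, a2, a3.trans (by simp; omega), a4]
    · have hx : x ∈ antipodalSet C := hx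
      rw [BinaryWord.ind_of_notMem (Set.disjoint_left.mp h23 hx)] at a1 a2 a3 a4
      rw [BinaryWord.ind_of_mem hx] at a1
      rw [BinaryWord.ind_of_notMem (Set.disjoint_right.mp hd hx)] at a2
      rw [BinaryWord.ind_of_notMem (Set.disjoint_left.mp h24 hx)] at a4
      fin_cases j <;> refine BinaryWord.encard_neighborSet_inter ?_
      exacts [a1, a2, a3.trans (by simp; omega), a4]
    · have hx : x ∈ thirdPart C := hx
      rw [BinaryWord.ind_of_mem hx] at a1 a2 a3 a4
      rw [BinaryWord.ind_of_notMem (Set.disjoint_right.mp h23 hx)] at a1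
      rw [BinaryWord.ind_of_notMem (Set.disjoint_right.mp h13 hx)] at a2
      rw [BinaryWord.ind_of_notMem (Set.disjoint_left.mp h34 hx)] at a4
      fin_cases j <;> refine BinaryWord.encard_neighborSet_inter ?_
      exacts [a1, a2, a3.trans (by simp; omega), a4]
    · have hx : x ∈ fourthPart C := hx
      rw [BinaryWord.ind_of_notMem (Set.disjoint_right.mp h34 hx)] at a1 a2 a3 a4
      rw [BinaryWord.ind_of_notMem (Set.disjoint_right.mp h24 hx)] at a1
      rw [BinaryWord.ind_of_notMem (Set.disjoint_right.mp h14 hx)] at a2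
      rw [BinaryWord.ind_of_mem hx] at a4
      fin_cases j <;> refine BinaryWord.encard_neighborSet_inter ?_
      exacts [a1, a2, a3.trans (by simp; omega), a4]
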